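/- Let $n\ge 0$ be an integer, $[n]=\{1,\dots,n\}$, let $g:\mathbb{R}\to\mathbb{R}$ be a (finite) convex function with $g(0)=0$, let $a\in\mathbb{R}^n$ with $a_i\neq 0$ for all $i\in[n]$, and let $\mathcal I_+\subseteq[n]$. Define $$\mathcal Q_1=\Big\{(t,x,z)\in\mathbb{R}\times\mathbb{R}^n\times\{0,1\}^n:\ t\ge g\Big(\sum_{i=1}^n a_ix_i\Big),\ x_i\ge 0\ \ \forall i\in\mathcal I_+,\ x_i(1-z_i)=0\ \ \forall i\in[n]\Big\},$$ and let the perspective function $g^\pi:\mathbb{R}\times\mathbb{R}\to\mathbb{R}\cup\{+\infty\}$ be given by $g^\pi(v,\lambda)=\lambda\, g(v/\lambda)$ if $\lambda>0$, $g^\pi(v,0)=\sup_{u\in\mathbb{R}}\,\big(g(u+v)-g(u)\big)$ (the recession function of $g$ at $v$), and $g^\pi(v,\lambda)=+\infty$ if $\lambda<0$. Then a point $(t,x,z)\in\mathbb{R}\times\mathbb{R}^n\times\mathbb{R}^n$ belongs to the closure of the convex hull of $\mathcal Q_1$ if and only if there exist $\lambda,\tau\in\mathbb{R}^n$ such that $$\begin{aligned}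 &t\ \ge\ \sum_{i=1}^n g^\pi\big(a_i(x_i-\tau_i),\lambda_i\big),\\ &a^\top\tau=0,\qquad 0\le\tau_i\le x_i\quad\forall i\in\mathcal I_+,\\ &\lambda_i\le z_i\le 1\quad\forall i\in[n],\\ &\lambda\ge 0,\qquad \sum_{i=1}^n\lambda_i\le 1 . \end{aligned}$$ -/

import Mathlib

noncomputable section

/-- The recession function of a finite convex function `f`, `y ↦ sup_x (f (x + y) - f x)`,
with values in `ℝ ∪ {+∞}`: it is the function whose epigraph is the recession cone of the
epigraph of `f`. -/
def recessionFunction {E : Type*} [AddCommGroup E] (f : E → ℝ) (y : E) : EReal :=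
  ⨆ x : E, ((f (x + y) - f x : ℝ) : EReal)

/-- The (closed) perspective function `f^π(x, l)` of a finite convex function `f`:
`l f(x / l)` for `l > 0`, the recession function of `f` at `x` for `l = 0`, and `+∞` for
`l < 0`. -/
def perspective {E : Type*} [AddCommGroup E] [Module ℝ E] (f : E → ℝ) (x : E) (l : ℝ) : EReal :=
  if 0 < l then ((l * f (l⁻¹ • x) : ℝ) : EReal)
  else if l = 0 then recessionFunction f x
  else ⊤

/-- The mixed-integer set `Q₁` of all `(t, x, z)` with `t ≥ g(∑ a_i x_i)`, `x_i ≥ 0` for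
`i ∈ Iplus`, `z` binary and `x_i (1 - z_i) = 0` for all `i`. -/
def rankOneSet {n : ℕ} (g : ℝ → ℝ) (a : Fin n → ℝ) (Iplus : Set (Fin n)) :
    Set (ℝ × (Fin n → ℝ) × (Fin n → ℝ)) :=
  {p | g (∑ i, a i * p.2.1 i) ≤ p.1 ∧
    (∀ i ∈ Iplus, 0 ≤ p.2.1 i) ∧
    (∀ i, p.2.2 i = 0 ∨ p.2.2 i = 1) ∧
    (∀ i, p.2.1 i * (1 - p.2.2 i) = 0)}

end

/-!
For `l ≥ 0` the perspective `g^π(v, l)` is the supremum of `c * v - b * l` over all affine minorants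
`u ↦ c * u - b` of `g` (`perspective_le_iff`): a subgradient at `v / l` attains it, and for `l = 0`
the differences `g (u + v) - g u` are bounded by the subgradients at `u + v`. With a real bound
`r i` on each perspective term, the system on the right-hand side therefore becomes a family of linear
inequalities in `(t, x, z, l, τ, r)`, and `certifiedSet` is the projection of a closed convex set
onto `(t, x, z)`.

*The closed convex hull is contained in `certifiedSet`.* That set is convex and contains
`rankOneSet`: given a point with `s = ∑ i, a i * x i`, the summands whose sign is opposite to that of
`s` are cancelled against the others by means of `τ`, and the remaining ones are fractions `l i * s`,
at which the perspective terms add up to `g s`. The same cancellation (`exists_damping`) applies to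
an arbitrary certificate: it does not increase the perspective terms, because it moves the arguments
of the convex function `g^π(·, l i)` from both sides towards `0` with a fixed sum. Afterwards all
terms `a i * (x i - τ i)` are bounded by `|s|`, so certificates of bounded points can be taken from a
compact set, and `certifiedSet` is closed (`isClosed_certifiedSet`).

*Every certified point is in the closed convex hull* (`certifiedSet_subset_closure`). The numbers
`l i`, together with `1 - ∑ i, l i`, are probabilities of choosing at most one index `i`. If `i` is
chosen, the `x`-part is `(x i - τ i) / l i` in coordinate `i` and `0` elsewhere, `z i = 1`, and the
other coordinates of `z` are independent with the marginals that make the mean equal to `z`. What is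
missing, `τ` and the terms with `l i = 0`, is a recession direction that can be followed over
`z = 1`, and its weight in `z` vanishes in the limit.
-/

open Filter Topology Set

/-! ### Affine minorants and the perspective function -/

/-- A finite convex function on the line has a subgradient `c` at every point. -/
theorem ConvexOn.exists_forall_add_mul_sub_le {g : ℝ → ℝ} (hg : ConvexOn ℝ univ g) (x : ℝ) :
    ∃ c, ∀ u, g x + c * (u - x) ≤ g u := by
  have hx : ∀ y : ℝ, y ∈ interior (univ : Set ℝ) := by simp
  refine ⟨derivWithin g (Ioi x) x, fun u => ?_⟩
  rcases lt_trichotomy u x with h | h | h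
  · have h1 := (hg.slope_le_leftDeriv_of_mem_interior (mem_univ u) (hx x) h).trans
      (hg.leftDeriv_le_rightDeriv_of_mem_interior (hx x))
    rw [slope_def_field, div_le_iff₀ (by linarith)] at h1
    linarith
  · simp [h]
  · have h1 := hg.rightDeriv_le_slope_of_mem_interior (hx x) (mem_univ u) h
    rw [slope_def_field, le_div_iff₀ (by linarith)] at h1
    linarith

/-- `(v, l, r)` satisfies `c * v - b * l ≤ r` for every affine minorant `u ↦ c * u - b` of `g`.
For convex `g` and `0 ≤ l` this says `g^π(v, l) ≤ r`. -/
def PerspectiveLE (g : ℝ → ℝ) (v l r : ℝ) : Prop :=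
  ∀ c b : ℝ, (∀ u, c * u - b ≤ g u) → c * v - b * l ≤ r

theorem recessionFunction_le_iff {g : ℝ → ℝ} (hg : ConvexOn ℝ univ g) {v r : ℝ} :
    recessionFunction g v ≤ (r : EReal) ↔ PerspectiveLE g v 0 r := by
  simp only [recessionFunction, iSup_le_iff, EReal.coe_le_coe_iff]
  constructor
  · intro h c b hcb
    -- Telescoping along multiples of `v` bounds the growth of `g`, hence the slope `c`.
    have hk : ∀ k : ℕ, g (k * v) ≤ g 0 + k * r := by
      intro k
      induction k with
      | zero => simp
      | succ k ih =>
        have h1 := h (k * v)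
        rw [show (k : ℝ) * v + v = (k + 1 : ℕ) * v by push_cast; ring] at h1
        push_cast at h1 ⊢
        linarith
    by_contra! hlt
    obtain ⟨k, hk'⟩ := exists_nat_gt ((g 0 + b) / (c * v - b * 0 - r))
    rw [div_lt_iff₀ (by linarith)] at hk'
    have h1 := hcb (k * v)
    have h2 := hk k
    nlinarith
  · intro h u
    obtain ⟨c, hc⟩ := hg.exists_forall_add_mul_sub_le (u + v)
    have h1 := h c (c * (u + v) - g (u + v)) fun w => by linarith [hc w]
    have h2 := hc u
    nlinarith

theorem perspective_le_iff {g : ℝ → ℝ} (hg : ConvexOn ℝ univ g) {v l r : ℝ} (hl : 0 ≤ l) :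
    perspective g v l ≤ (r : EReal) ↔ PerspectiveLE g v l r := by
  rcases hl.eq_or_lt with rfl | hl
  · simpa [perspective] using recessionFunction_le_iff hg
  rw [perspective, if_pos hl, EReal.coe_le_coe_iff, smul_eq_mul]
  have hv : l * (l⁻¹ * v) = v := mul_inv_cancel_left₀ hl.ne' v
  constructor
  · intro h c b hcb
    have h1 := mul_le_mul_of_nonneg_left (hcb (l⁻¹ * v)) hl.le
    have h2 : l * (c * (l⁻¹ * v) - b) = c * v - b * l := by
      linear_combination c * hv
    linarith
  · intro h
    obtain ⟨c, hc⟩ := hg.exists_forall_add_mul_sub_le (l⁻¹ * v)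
    have h1 := h c (c * (l⁻¹ * v) - g (l⁻¹ * v)) fun w => by linarith [hc w]
    have h2 : c * v - (c * (l⁻¹ * v) - g (l⁻¹ * v)) * l = l * g (l⁻¹ * v) := by
      linear_combination -c * hv
    linarith

theorem perspective_ne_bot {g : ℝ → ℝ} (hg : ConvexOn ℝ univ g) {v l : ℝ} (hl : 0 ≤ l) :
    perspective g v l ≠ ⊥ := by
  intro h
  obtain ⟨c, hc⟩ := hg.exists_forall_add_mul_sub_le 0
  have h1 := (perspective_le_iff hg (r := c * v + g 0 * l - 1) hl).1 (h ▸ bot_le) c (-g 0)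
    fun w => by linarith [hc w]
  linarith

/-! ### Finite sums of extended reals -/

theorem EReal.sum_ne_bot {ι : Type*} {s : Finset ι} {f : ι → EReal} (hf : ∀ i ∈ s, f i ≠ ⊥) :
    ∑ i ∈ s, f i ≠ ⊥ := by
  classical
  induction s using Finset.induction_on with
  | empty => simp
  | insert i s hi ih =>
    rw [Finset.sum_insert hi, Ne, EReal.add_eq_bot_iff, not_or]
    exact ⟨hf i (by simp), ih fun j hj => hf j (by simp [hj])⟩

theorem EReal.coe_finset_sum {ι : Type*} (s : Finset ι) (f : ι → ℝ) :
    ((∑ i ∈ s, f i : ℝ) : EReal) = ∑ i ∈ s, (f i : EReal) := by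
  classical
  induction s using Finset.induction_on with
  | empty => simp
  | insert i s hi ih => rw [Finset.sum_insert hi, Finset.sum_insert hi, EReal.coe_add, ih]

theorem EReal.sum_le_coe_iff {ι : Type*} [Fintype ι] {f : ι → EReal} (hf : ∀ i, f i ≠ ⊥)
    {t : ℝ} :
    ∑ i, f i ≤ (t : EReal) ↔ ∃ r : ι → ℝ, (∀ i, f i ≤ (r i : EReal)) ∧ ∑ i, r i ≤ t := by
  classical
  constructor
  · intro h
    have htop : ∀ i, f i ≠ ⊤ := by
      intro i hi
      rw [← Finset.add_sum_erase _ _ (Finset.mem_univ i), hi,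
        EReal.top_add_of_ne_bot (EReal.sum_ne_bot fun j _ => hf j), top_le_iff] at h
      exact EReal.coe_ne_top _ h
    have hcoe : ∀ i, ((f i).toReal : EReal) = f i := fun i => EReal.coe_toReal (htop i) (hf i)
    refine ⟨fun i => (f i).toReal, fun i => (hcoe i).ge, ?_⟩
    rw [← EReal.coe_le_coe_iff, EReal.coe_finset_sum]
    simpa only [hcoe] using h
  · rintro ⟨r, hr, hrt⟩
    calc ∑ i, f i ≤ ∑ i, (r i : EReal) := Finset.sum_le_sum fun i _ => hr i
      _ = ((∑ i, r i : ℝ) : EReal) := (EReal.coe_finset_sum _ _).symm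
      _ ≤ t := EReal.coe_le_coe_iff.2 hrt

/-! ### Certificates -/

variable {n : ℕ}

/-- The data `(l, τ, r)` certify that `(t, x, z)` satisfies the system in the theorem; `r i` is
a real upper bound for the `i`-th perspective term, which makes every condition a (closed) linear
inequality. -/
structure IsCertificate (g : ℝ → ℝ) (a : Fin n → ℝ) (Iplus : Set (Fin n))
    (t : ℝ) (x z l τ r : Fin n → ℝ) : Prop where
  perspectiveLE : ∀ i, PerspectiveLE g (a i * (x i - τ i)) (l i) (r i)
  sum_r_le : ∑ i, r i ≤ t
  sum_mul_tau : ∑ i, a i * τ i = 0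
  tau_mem : ∀ i ∈ Iplus, 0 ≤ τ i ∧ τ i ≤ x i
  l_le : ∀ i, l i ≤ z i
  z_le : ∀ i, z i ≤ 1
  l_nonneg : ∀ i, 0 ≤ l i
  sum_l_le : ∑ i, l i ≤ 1

/-- The set of all points that possess a certificate. -/
def certifiedSet (g : ℝ → ℝ) (a : Fin n → ℝ) (Iplus : Set (Fin n)) :
    Set (ℝ × (Fin n → ℝ) × (Fin n → ℝ)) :=
  {p | ∃ l τ r, IsCertificate g a Iplus p.1 p.2.1 p.2.2 l τ r}

theorem mem_certifiedSet_iff {g : ℝ → ℝ} (hg : ConvexOn ℝ univ g) {a : Fin n → ℝ}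
    {Iplus : Set (Fin n)} {t : ℝ} {x z : Fin n → ℝ} :
    (t, x, z) ∈ certifiedSet g a Iplus ↔
      ∃ l τ : Fin n → ℝ,
        (∑ i, perspective g (a i * (x i - τ i)) (l i) ≤ (t : EReal)) ∧
        (∑ i, a i * τ i = 0) ∧ (∀ i ∈ Iplus, 0 ≤ τ i ∧ τ i ≤ x i) ∧
        (∀ i, l i ≤ z i ∧ z i ≤ 1) ∧
        (∀ i, 0 ≤ l i) ∧ ∑ i, l i ≤ 1 := by
  constructor
  · rintro ⟨l, τ, r, h⟩
    refine ⟨l, τ, ?_, h.sum_mul_tau, h.tau_mem, fun i => ⟨h.l_le i, h.z_le i⟩, h.l_nonneg,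
      h.sum_l_le⟩
    rw [EReal.sum_le_coe_iff fun i => perspective_ne_bot hg (h.l_nonneg i)]
    exact ⟨r, fun i => (perspective_le_iff hg (h.l_nonneg i)).2 (h.perspectiveLE i), h.sum_r_le⟩
  · rintro ⟨l, τ, h1, h2, h3, h4, h5, h6⟩
    rw [EReal.sum_le_coe_iff fun i => perspective_ne_bot hg (h5 i)] at h1
    obtain ⟨r, hr, hrt⟩ := h1
    exact ⟨l, τ, r, fun i => (perspective_le_iff hg (h5 i)).1 (hr i), hrt, h2, h3,
      fun i => (h4 i).1, fun i => (h4 i).2, h5, h6⟩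

theorem convex_certifiedSet (g : ℝ → ℝ) (a : Fin n → ℝ) (Iplus : Set (Fin n)) :
    Convex ℝ (certifiedSet g a Iplus) := by
  rintro ⟨t, x, z⟩ ⟨l, τ, r, h⟩ ⟨t', x', z'⟩ ⟨l', τ', r', h'⟩ α β hα hβ hαβ
  have key : ∀ {p q p' q' : ℝ}, p ≤ q → p' ≤ q' → α * p + β * p' ≤ α * q + β * q' :=
    fun h h' => add_le_add (mul_le_mul_of_nonneg_left h hα) (mul_le_mul_of_nonneg_left h' hβ)
  have hsum : ∀ u u' : Fin n → ℝ, ∑ i, (α • u + β • u') i = α * ∑ i, u i + β * ∑ i, u' i := by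
    intro u u'
    simp [Finset.sum_add_distrib, Finset.mul_sum]
  refine ⟨α • l + β • l', α • τ + β • τ', α • r + β • r', ?_, ?_, ?_, ?_, ?_, ?_, ?_, ?_⟩
  · intro i c b hcb
    have := key (h.perspectiveLE i c b hcb) (h'.perspectiveLE i c b hcb)
    simp only [Prod.smul_mk, Prod.mk_add_mk, Pi.add_apply, Pi.smul_apply, smul_eq_mul]
    linarith
  · rw [hsum]
    exact key h.sum_r_le h'.sum_r_le
  · have := hsum (fun i => a i * τ i) (fun i => a i * τ' i)
    rw [h.sum_mul_tau, h'.sum_mul_tau, mul_zero, mul_zero, add_zero] at this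
    rw [← this]
    refine Finset.sum_congr rfl fun i _ => ?_
    simp only [Pi.add_apply, Pi.smul_apply, smul_eq_mul]
    ring
  · intro i hi
    have h0 := key (h.tau_mem i hi).1 (h'.tau_mem i hi).1
    have h1 := key (h.tau_mem i hi).2 (h'.tau_mem i hi).2
    rw [mul_zero, mul_zero, add_zero] at h0
    exact ⟨h0, h1⟩
  · exact fun i => key (h.l_le i) (h'.l_le i)
  · intro i
    have := key (h.z_le i) (h'.z_le i)
    rw [mul_one, mul_one, hαβ] at this
    exact this
  · intro i
    have := key (h.l_nonneg i) (h'.l_nonneg i)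
    rw [mul_zero, mul_zero, add_zero] at this
    exact this
  · rw [hsum]
    have := key h.sum_l_le h'.sum_l_le
    rwa [mul_one, mul_one, hαβ] at this

/-! ### Cancellation of summands of opposite sign -/

/-- The summands of a finite real sum `s` can be damped so that the sum is unchanged and every
summand becomes a nonnegative fraction `μ i` of `s`. -/
theorem exists_damping {ι : Type*} [Fintype ι] (v : ι → ℝ) :
    ∃ θ μ : ι → ℝ, (∀ i, 0 ≤ θ i ∧ θ i ≤ 1) ∧ (∀ i, 0 ≤ μ i) ∧ ∑ i, μ i ≤ 1 ∧
      (∀ i, θ i * v i = μ i * ∑ j, v j) ∧ (∀ i, v i = 0 → μ i = 0) ∧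
      ∑ i, θ i * v i = ∑ i, v i := by
  have pos : ∀ v : ι → ℝ, 0 < ∑ i, v i →
      ∃ θ μ : ι → ℝ, (∀ i, 0 ≤ θ i ∧ θ i ≤ 1) ∧ (∀ i, 0 ≤ μ i) ∧ ∑ i, μ i ≤ 1 ∧
      (∀ i, θ i * v i = μ i * ∑ j, v j) ∧ (∀ i, v i = 0 → μ i = 0) ∧
      ∑ i, θ i * v i = ∑ i, v i := by
    intro v hs
    have hsP : ∑ i, v i ≤ ∑ i, max (v i) 0 := Finset.sum_le_sum fun i _ => le_max_left _ _
    set s := ∑ i, v i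
    set P := ∑ i, max (v i) 0 with hP
    have hP0 : 0 < P := hs.trans_le hsP
    have hterm : ∀ i, (if 0 < v i then s / P else 0) * v i = max (v i) 0 / P * s := by
      intro i
      split_ifs with h
      · rw [max_eq_left h.le]; ring
      · rw [max_eq_right (not_lt.1 h)]; simp
    have hone : ∑ i, max (v i) 0 / P = 1 := by
      rw [← Finset.sum_div, ← hP, div_self hP0.ne']
    refine ⟨fun i => if 0 < v i then s / P else 0, fun i => max (v i) 0 / P, fun i => ?_,
      fun i => div_nonneg (le_max_right _ _) hP0.le, hone.le, hterm, fun i hi => by simp [hi], ?_⟩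
    · dsimp only
      split_ifs
      · exact ⟨by positivity, div_le_one_of_le₀ hsP hP0.le⟩
      · simp
    · simp only [hterm]
      rw [← Finset.sum_mul, hone, one_mul]
  rcases lt_trichotomy (∑ i, v i) 0 with h | h | h
  · obtain ⟨θ, μ, h0, h1, h2, h3, h4, h5⟩ := pos (fun i => -v i) (by simpa using h)
    exact ⟨θ, μ, h0, h1, h2, by simpa using h3, by simpa using h4, by simpa using h5⟩
  · exact ⟨0, 0, by simp, by simp, by simp, by simp, by simp, by simp [h]⟩
  · exact pos v h

/-- A point of `rankOneSet` with `s = ∑ i, a i * x i` is certified by the fractions `l i` of `s`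
to which the summands are damped: then `a i * (x i - τ i) = l i * s`, and the perspective terms
add up to `g s`. -/
theorem rankOneSet_subset_certifiedSet {g : ℝ → ℝ} (hg0 : g 0 = 0) (a : Fin n → ℝ)
    (Iplus : Set (Fin n)) : rankOneSet g a Iplus ⊆ certifiedSet g a Iplus := by
  rintro ⟨t, x, z⟩ ⟨ht, hx, hz, hxz⟩
  dsimp only at ht hx hz hxz
  obtain ⟨θ, l, hθ, hl0, hls, hθl, hl, hsum⟩ := exists_damping fun i => a i * x i
  set s := ∑ i, a i * x i with hs
  refine ⟨l, fun i => (1 - θ i) * x i, fun i => l i * g s, ?_, ?_, ?_, ?_, ?_, ?_, hl0, hls⟩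
  · intro i c b hcb
    dsimp only
    rw [show a i * (x i - (1 - θ i) * x i) = l i * s by linear_combination hθl i]
    have := mul_le_mul_of_nonneg_left (hcb s) (hl0 i)
    linarith
  · rw [← Finset.sum_mul]
    rcases eq_or_ne s 0 with h | h
    · simpa [h, hg0] using ht
    · have h1 : (∑ i, l i) * s = 1 * s := by
        rw [Finset.sum_mul, one_mul, Finset.sum_congr rfl fun i _ => (hθl i).symm, hsum]
      rw [mul_right_cancel₀ h h1, one_mul]
      exact ht
  · have : ∑ i, a i * ((1 - θ i) * x i) = ∑ i, a i * x i - ∑ i, θ i * (a i * x i) := by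
      rw [← Finset.sum_sub_distrib]
      exact Finset.sum_congr rfl fun i _ => by ring
    rw [this, hsum, hs, sub_self]
  · intro i hi
    have h1 := hx i hi
    have h2 := hθ i
    dsimp only
    constructor <;> nlinarith
  · intro i
    dsimp only
    rcases hz i with h | h
    · have h1 := hxz i
      rw [h, sub_zero, mul_one] at h1
      rw [hl i (by rw [h1, mul_zero]), h]
    · rw [h]
      exact (Finset.single_le_sum (fun j _ => hl0 j) (Finset.mem_univ i)).trans hls
  · intro i
    rcases hz i with h | h <;> simp [h]

/-- Damping the terms `a i * (x i - τ i)` to the sign of their sum keeps a certificate valid. It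
does not increase the perspective terms because, after subtracting a subgradient of `g` at `0`
(whose contribution depends on the sum only), they are nonnegative and vanish at `0`. -/
theorem IsCertificate.exists_bounded {g : ℝ → ℝ} (hg : ConvexOn ℝ univ g) (hg0 : g 0 = 0)
    {a : Fin n → ℝ} {Iplus : Set (Fin n)} {t : ℝ} {x z l τ r : Fin n → ℝ}
    (h : IsCertificate g a Iplus t x z l τ r) :
    ∃ τ' r', IsCertificate g a Iplus t x z l τ' r' ∧
      ∀ i, |a i * (x i - τ' i)| ≤ |∑ j, a j * x j| := by
  obtain ⟨θ, μ, hθ, hμ0, hμ, hθμ, -, hsum⟩ := exists_damping fun i => a i * (x i - τ i)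
  have hs : ∑ i, a i * (x i - τ i) = ∑ i, a i * x i := by
    simp only [mul_sub, Finset.sum_sub_distrib, h.sum_mul_tau, sub_zero]
  rw [hs] at hsum hθμ
  have hv : ∀ i, a i * (x i - (x i - θ i * (x i - τ i))) = θ i * (a i * (x i - τ i)) :=
    fun i => by ring
  refine ⟨fun i => x i - θ i * (x i - τ i), fun i => θ i * r i,
    ⟨?_, ?_, ?_, ?_, h.l_le, h.z_le, h.l_nonneg, h.sum_l_le⟩, ?_⟩
  · intro i c b hcb
    have h1 := mul_le_mul_of_nonneg_left (h.perspectiveLE i c b hcb) (hθ i).1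
    have hb : 0 ≤ b := by
      have := hcb 0
      linarith
    have h2 := mul_nonneg (mul_nonneg (sub_nonneg.2 (hθ i).2) hb) (h.l_nonneg i)
    rw [hv]
    linarith
  · obtain ⟨c, hc⟩ := hg.exists_forall_add_mul_sub_le 0
    refine le_trans ?_ h.sum_r_le
    have h1 : ∀ i, θ i * r i ≤ r i - c * (a i * (x i - τ i)) + c * (θ i * (a i * (x i - τ i))) := by
      intro i
      have h2 := h.perspectiveLE i c 0 fun u => by
        have := hc u
        rw [hg0] at this
        linarith
      nlinarith [hθ i]
    calc ∑ i, θ i * r i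
        ≤ ∑ i, (r i - c * (a i * (x i - τ i)) + c * (θ i * (a i * (x i - τ i)))) :=
          Finset.sum_le_sum fun i _ => h1 i
      _ = ∑ i, r i := by
          rw [Finset.sum_add_distrib, Finset.sum_sub_distrib, ← Finset.mul_sum, ← Finset.mul_sum,
            hsum, hs, sub_add_cancel]
  · simp only [mul_sub, Finset.sum_sub_distrib] at hsum ⊢
    simp only [mul_left_comm (a _) (θ _)]
    linarith
  · intro i hi
    have h1 := h.tau_mem i hi
    have h2 := hθ i
    constructor <;> nlinarith
  · intro i
    rw [hv, hθμ, abs_mul, abs_of_nonneg (hμ0 i)]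
    refine mul_le_of_le_one_left (abs_nonneg _) ?_
    exact (Finset.single_le_sum (fun j _ => hμ0 j) (Finset.mem_univ i)).trans hμ

/-! ### Closedness of the certified set -/

theorem isCertificate_iff {g : ℝ → ℝ} {a : Fin n → ℝ} {Iplus : Set (Fin n)} {t : ℝ}
    {x z l τ r : Fin n → ℝ} :
    IsCertificate g a Iplus t x z l τ r ↔
      (∀ i, PerspectiveLE g (a i * (x i - τ i)) (l i) (r i)) ∧ ∑ i, r i ≤ t ∧
      ∑ i, a i * τ i = 0 ∧ (∀ i ∈ Iplus, 0 ≤ τ i ∧ τ i ≤ x i) ∧ (∀ i, l i ≤ z i) ∧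
      (∀ i, z i ≤ 1) ∧ (∀ i, 0 ≤ l i) ∧ ∑ i, l i ≤ 1 :=
  ⟨fun ⟨h1, h2, h3, h4, h5, h6, h7, h8⟩ => ⟨h1, h2, h3, h4, h5, h6, h7, h8⟩,
    fun ⟨h1, h2, h3, h4, h5, h6, h7, h8⟩ => ⟨h1, h2, h3, h4, h5, h6, h7, h8⟩⟩

theorem isClosed_setOf_isCertificate (g : ℝ → ℝ) (a : Fin n → ℝ) (Iplus : Set (Fin n)) :
    IsClosed {q : (ℝ × (Fin n → ℝ) × (Fin n → ℝ)) × (Fin n → ℝ) × (Fin n → ℝ) × (Fin n → ℝ) |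
      IsCertificate g a Iplus q.1.1 q.1.2.1 q.1.2.2 q.2.1 q.2.2.1 q.2.2.2} := by
  simp only [isCertificate_iff, PerspectiveLE, ofPred_and, ofPred_forall]
  refine .inter ?_ <| .inter ?_ <| .inter ?_ <| .inter ?_ <| .inter ?_ <| .inter ?_ <|
    .inter ?_ ?_
  · exact isClosed_iInter fun i => isClosed_iInter fun c => isClosed_iInter fun b =>
      isClosed_iInter fun _ => isClosed_le (by fun_prop) (by fun_prop)
  · exact isClosed_le (by fun_prop) (by fun_prop)
  · exact isClosed_eq (by fun_prop) (by fun_prop)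
  · exact isClosed_iInter fun i => isClosed_iInter fun _ =>
      (isClosed_le (by fun_prop) (by fun_prop)).inter (isClosed_le (by fun_prop) (by fun_prop))
  · exact isClosed_iInter fun i => isClosed_le (by fun_prop) (by fun_prop)
  · exact isClosed_iInter fun i => isClosed_le (by fun_prop) (by fun_prop)
  · exact isClosed_iInter fun i => isClosed_le (by fun_prop) (by fun_prop)
  · exact isClosed_le (by fun_prop) (by fun_prop)

/-- The bounds of `IsCertificate.exists_bounded` on `τ` bound `r` from below by a subgradient of `g`
at `0`, and then from above by `∑ i, r i ≤ t`. -/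
theorem exists_uniform_certificate_bound {g : ℝ → ℝ} (hg : ConvexOn ℝ univ g) (hg0 : g 0 = 0)
    {a : Fin n → ℝ} (ha : ∀ i, a i ≠ 0) (Iplus : Set (Fin n)) (M : ℝ) :
    ∃ R, ∀ p ∈ certifiedSet g a Iplus, ‖p‖ ≤ M →
      ∃ q : (Fin n → ℝ) × (Fin n → ℝ) × (Fin n → ℝ),
        IsCertificate g a Iplus p.1 p.2.1 p.2.2 q.1 q.2.1 q.2.2 ∧ ‖q‖ ≤ R := by
  obtain ⟨c, hc⟩ := hg.exists_forall_add_mul_sub_le 0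
  set S : ℝ := (∑ j, |a j|) * M with hS
  set A : ℝ := M + (∑ j, |a j|⁻¹) * S with hA
  set B : ℝ := M + (n + 1) * (|c| * S) with hB
  refine ⟨1 + A + B, ?_⟩
  rintro ⟨t, x, z⟩ ⟨l, τ₀, r₀, h₀⟩ hp
  obtain ⟨τ, r, h, hv⟩ := h₀.exists_bounded hg hg0
  dsimp only at h hv
  have hM : 0 ≤ M := (norm_nonneg _).trans hp
  have ht : t ≤ M := (le_abs_self t).trans ((norm_fst_le (t, x, z)).trans hp)
  have hx : ∀ i, |x i| ≤ M := fun i =>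
    (norm_le_pi_norm x i).trans ((norm_fst_le (x, z)).trans ((norm_snd_le (t, x, z)).trans hp))
  have hS0 : 0 ≤ S := mul_nonneg (Finset.sum_nonneg fun _ _ => abs_nonneg _) hM
  have hcS : 0 ≤ |c| * S := by positivity
  have hA0 : 0 ≤ A :=
    add_nonneg hM (mul_nonneg (Finset.sum_nonneg fun _ _ => inv_nonneg.2 (abs_nonneg _)) hS0)
  have hB0 : 0 ≤ B := by positivity
  have hvS : ∀ i, |a i * (x i - τ i)| ≤ S := by
    intro i
    refine (hv i).trans ((Finset.abs_sum_le_sum_abs _ _).trans ?_)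
    rw [hS, Finset.sum_mul]
    refine Finset.sum_le_sum fun j _ => ?_
    rw [abs_mul]
    exact mul_le_mul_of_nonneg_left (hx j) (abs_nonneg _)
  have hl : ‖l‖ ≤ 1 := (pi_norm_le_iff_of_nonneg zero_le_one).2 fun i => by
    rw [Real.norm_of_nonneg (h.l_nonneg i)]
    exact (Finset.single_le_sum (fun j _ => h.l_nonneg j) (Finset.mem_univ i)).trans h.sum_l_le
  have hτ : ‖τ‖ ≤ A := (pi_norm_le_iff_of_nonneg hA0).2 fun i => by
    have h1 : |x i - τ i| ≤ (∑ j, |a j|⁻¹) * S := by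
      calc |x i - τ i| = |a i|⁻¹ * |a i * (x i - τ i)| := by
            rw [abs_mul, inv_mul_cancel_left₀ (abs_ne_zero.2 (ha i))]
        _ ≤ |a i|⁻¹ * S := mul_le_mul_of_nonneg_left (hvS i) (by positivity)
        _ ≤ _ := mul_le_mul_of_nonneg_right
            (Finset.single_le_sum (f := fun j => |a j|⁻¹) (fun j _ => by positivity)
              (Finset.mem_univ i)) hS0
    have h2 := hx i
    rw [Real.norm_eq_abs]
    rw [abs_le] at *
    constructor <;> linarith
  have hr0 : ∀ i, 0 ≤ r i + |c| * S := by
    intro i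
    have h1 := h.perspectiveLE i c 0 fun u => by
      have := hc u
      rw [hg0] at this
      linarith
    have h2 : |c * (a i * (x i - τ i))| ≤ |c| * S := by
      rw [abs_mul]
      exact mul_le_mul_of_nonneg_left (hvS i) (abs_nonneg _)
    linarith [(abs_le.1 h2).1]
  have hr : ‖r‖ ≤ B := (pi_norm_le_iff_of_nonneg hB0).2 fun i => by
    have h1 := Finset.single_le_sum (fun j _ => hr0 j) (Finset.mem_univ i)
    rw [Finset.sum_add_distrib, Finset.sum_const, Finset.card_univ, Fintype.card_fin,
      nsmul_eq_mul] at h1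
    have h2 := h.sum_r_le
    have h3 := hr0 i
    have h4 : 0 ≤ (n : ℝ) * (|c| * S) := by positivity
    rw [Real.norm_eq_abs, abs_le]
    constructor <;> linarith
  refine ⟨(l, τ, r), h, norm_prod_le_iff.2 ⟨?_, norm_prod_le_iff.2 ⟨?_, ?_⟩⟩⟩ <;>
    dsimp only <;> linarith

theorem isClosed_certifiedSet {g : ℝ → ℝ} (hg : ConvexOn ℝ univ g) (hg0 : g 0 = 0)
    {a : Fin n → ℝ} (ha : ∀ i, a i ≠ 0) (Iplus : Set (Fin n)) :
    IsClosed (certifiedSet g a Iplus) := by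
  refine IsSeqClosed.isClosed fun p p₀ hp hlim => ?_
  obtain ⟨M, hM⟩ := (Metric.isBounded_range_of_tendsto p hlim).exists_norm_le
  obtain ⟨R, hR⟩ := exists_uniform_certificate_bound hg hg0 ha Iplus M
  choose q hq hqR using fun k => hR (p k) (hp k) (hM _ (mem_range_self k))
  obtain ⟨q₀, -, φ, hφ, hq₀⟩ := (isCompact_closedBall 0 R).tendsto_subseq
    fun k => mem_closedBall_zero_iff.2 (hqR k)
  exact ⟨q₀.1, q₀.2.1, q₀.2.2, (isClosed_setOf_isCertificate g a Iplus).mem_of_tendsto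
    ((hlim.comp hφ.tendsto_atTop).prodMk_nhds hq₀) (.of_forall fun k => hq (φ k))⟩

/-! ### Certified points lie in the closed convex hull -/

/-- Over a fixed `(t, x)`, the convex hull of the admissible binary vectors `z` is a box. -/
theorem mem_convexHull_rankOneSet {g : ℝ → ℝ} {a : Fin n → ℝ} {Iplus : Set (Fin n)} {t : ℝ}
    {x z : Fin n → ℝ} (ht : g (∑ i, a i * x i) ≤ t) (hx : ∀ i ∈ Iplus, 0 ≤ x i)
    (hz : ∀ i, 0 ≤ z i ∧ z i ≤ 1) (hxz : ∀ i, x i ≠ 0 → z i = 1) :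
    (t, x, z) ∈ convexHull ℝ (rankOneSet g a Iplus) := by
  set T : Fin n → Set ℝ := fun i => {u | (u = 0 ∨ u = 1) ∧ x i * (1 - u) = 0} with hT
  have hsub : ({t} ×ˢ {x} ×ˢ univ.pi T : Set (ℝ × (Fin n → ℝ) × (Fin n → ℝ))) ⊆
      rankOneSet g a Iplus := by
    rintro ⟨t', x', u⟩ ⟨rfl, rfl, hu⟩
    exact ⟨ht, hx, fun i => (hu i (mem_univ i)).1, fun i => (hu i (mem_univ i)).2⟩
  refine convexHull_mono hsub ?_
  rw [convexHull_prod, convexHull_prod, convexHull_pi, convexHull_singleton, convexHull_singleton]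
  refine ⟨rfl, rfl, fun i _ => ?_⟩
  dsimp only
  by_cases h : x i = 0
  · have : T i = {0, 1} := by
      ext u
      simp [hT, h]
    rw [this, convexHull_pair, segment_eq_Icc zero_le_one]
    exact hz i
  · rw [hxz i h]
    exact subset_convexHull ℝ _ (by simp [hT])

/-- A direction `(ρ, y, 0)` that can be followed arbitrarily far within `rankOneSet`, over
`z = 1`, is a recession direction of the closed convex hull. -/
theorem add_mem_closure_convexHull_rankOneSet {g : ℝ → ℝ} {a : Fin n → ℝ} {Iplus : Set (Fin n)}
    {ρ : ℝ} {y : Fin n → ℝ} (hy : ∀ i ∈ Iplus, 0 ≤ y i)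
    (hρ : ∀ K : ℝ, 0 < K → g (K * ∑ i, a i * y i) ≤ K * ρ)
    {p : ℝ × (Fin n → ℝ) × (Fin n → ℝ)} (hp : p ∈ convexHull ℝ (rankOneSet g a Iplus)) :
    p + (ρ, y, 0) ∈ closure (convexHull ℝ (rankOneSet g a Iplus)) := by
  have hmem : ∀ ε ∈ Ioo (0 : ℝ) 1, (1 - ε) • p + (ρ, y, fun _ => ε) ∈
      convexHull ℝ (rankOneSet g a Iplus) := by
    rintro ε ⟨hε0, hε1⟩
    have hfar : (ε⁻¹ * ρ, ε⁻¹ • y, fun _ => (1 : ℝ)) ∈ rankOneSet g a Iplus := by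
      refine ⟨?_, fun i hi => mul_nonneg (by positivity) (hy i hi), fun _ => Or.inr rfl,
        fun i => by simp⟩
      convert hρ ε⁻¹ (by positivity) using 2
      rw [Finset.mul_sum]
      exact Finset.sum_congr rfl fun i _ => by simp; ring
    have h := convex_convexHull ℝ (rankOneSet g a Iplus) hp (subset_convexHull ℝ _ hfar)
      (sub_nonneg.2 hε1.le) hε0.le (by ring)
    convert h using 2
    ext i
    · simp [hε0.ne']
    · simp [hε0.ne']
    · simp
  have hlim : Tendsto (fun ε : ℝ => (1 - ε) • p + (ρ, y, fun _ : Fin n => ε)) (𝓝[>] 0)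
      (𝓝 (p + (ρ, y, 0))) := by
    have hcont : Continuous fun ε : ℝ => (1 - ε) • p + (ρ, y, fun _ : Fin n => ε) := by fun_prop
    have := hcont.tendsto 0
    simp only [sub_zero, one_smul] at this
    exact this.mono_left nhdsWithin_le_nhds
  exact mem_closure_of_tendsto hlim
    (by filter_upwards [Ioo_mem_nhdsGT (zero_lt_one' ℝ)] with ε hε using hmem ε hε)

/-- Since `g 0 = 0`, the recession function bounds `g` along the whole ray through `v`. -/
theorem PerspectiveLE.apply_mul_le {g : ℝ → ℝ} (hg : ConvexOn ℝ univ g) (hg0 : g 0 = 0)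
    {v ρ : ℝ} (h : PerspectiveLE g v 0 ρ) {K : ℝ} (hK : 0 < K) : g (K * v) ≤ K * ρ := by
  obtain ⟨c, hc⟩ := hg.exists_forall_add_mul_sub_le (K * v)
  have h1 := h c (c * (K * v) - g (K * v)) fun w => by linarith [hc w]
  have h2 := hc 0
  nlinarith

theorem PerspectiveLE.apply_div_le {g : ℝ → ℝ} (hg : ConvexOn ℝ univ g)
    {v l ρ : ℝ} (h : PerspectiveLE g v l ρ) (hl : 0 < l) : g (v / l) ≤ ρ / l := by
  obtain ⟨c, hc⟩ := hg.exists_forall_add_mul_sub_le (v / l)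
  have h1 := h c (c * (v / l) - g (v / l)) fun w => by linarith [hc w]
  rw [le_div_iff₀ hl]
  have h2 : c * (v / l) * l = c * v := by field_simp
  linarith

/-- The indices with `0 < l i` contribute to a convex combination of points whose `x`-part is
supported at one index; the indices with `l i = 0`, the vector `τ` and the slack in `t` make up one
recession direction. -/
theorem certifiedSet_subset_closure {g : ℝ → ℝ} (hg : ConvexOn ℝ univ g) (hg0 : g 0 = 0)
    (a : Fin n → ℝ) (Iplus : Set (Fin n)) :
    certifiedSet g a Iplus ⊆ closure (convexHull ℝ (rankOneSet g a Iplus)) := by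
  rintro ⟨t, x, z⟩ ⟨l, τ, r, h⟩
  dsimp only at h
  have hl1 : ∀ i, l i ≤ 1 := fun i =>
    (Finset.single_le_sum (fun j _ => h.l_nonneg j) (Finset.mem_univ i)).trans h.sum_l_le
  -- `m j` is the conditional probability of `z j = 1`, given that `j` is not the chosen index.
  set m : Fin n → ℝ := fun j => (z j - l j) / (1 - l j) with hm
  have hm01 : ∀ j, 0 ≤ m j ∧ m j ≤ 1 := fun j =>
    ⟨div_nonneg (sub_nonneg.2 (h.l_le j)) (sub_nonneg.2 (hl1 j)),
      div_le_one_of_le₀ (by linarith [h.z_le j]) (sub_nonneg.2 (hl1 j))⟩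
  have hmz : ∀ j, l j + (1 - l j) * m j = z j := by
    intro j
    rcases eq_or_ne (1 - l j) 0 with h1 | h1
    · have := h.l_le j
      have := h.z_le j
      rw [h1]
      linarith
    · simp only [hm]
      rw [mul_div_cancel₀ _ h1]
      ring
  -- For `l i = 0` the divisions below give `0`, and the point has weight `0` anyway.
  set P : Fin n → ℝ × (Fin n → ℝ) × (Fin n → ℝ) := fun i =>
    (r i / l i, Pi.single i ((x i - τ i) / l i), Function.update m i 1) with hP
  have hPmem : ∀ i, P i ∈ convexHull ℝ (rankOneSet g a Iplus) := by
    intro i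
    refine mem_convexHull_rankOneSet ?_ ?_ ?_ ?_
    · have : ∑ j, a j * (Pi.single i ((x i - τ i) / l i) : Fin n → ℝ) j =
          a i * (x i - τ i) / l i := by
        rw [Finset.sum_eq_single i (fun j _ hj => by simp [hj]) (by simp)]
        simp [mul_div_assoc]
      rw [this]
      rcases (h.l_nonneg i).eq_or_lt with h0 | h0
      · simp [← h0, hg0]
      · exact (h.perspectiveLE i).apply_div_le hg h0
    · intro j hj
      rcases eq_or_ne j i with rfl | hji
      · rw [Pi.single_eq_same]
        exact div_nonneg (sub_nonneg.2 (h.tau_mem j hj).2) (h.l_nonneg j)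
      · simp [hji]
    · intro j
      rcases eq_or_ne j i with rfl | hji
      · simp
      · simpa [hji] using hm01 j
    · intro j hj
      rcases eq_or_ne j i with rfl | hji
      · simp
      · simp [hji] at hj
  have hQ : ((0 : ℝ), (0 : Fin n → ℝ), m) ∈ convexHull ℝ (rankOneSet g a Iplus) :=
    mem_convexHull_rankOneSet (by simp [hg0]) (by simp) hm01 (by simp)
  have hcomb : ∑ i, l i • P i + (1 - ∑ i, l i) • ((0 : ℝ), (0 : Fin n → ℝ), m) ∈
      convexHull ℝ (rankOneSet g a Iplus) := by
    have := (convex_convexHull ℝ (rankOneSet g a Iplus)).sum_mem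
      (t := Finset.univ) (w := fun o : Option (Fin n) => o.elim (1 - ∑ i, l i) l)
      (z := fun o => o.elim ((0 : ℝ), (0 : Fin n → ℝ), m) P)
      (by rintro (_ | i) -
          · exact sub_nonneg.2 h.sum_l_le
          · exact h.l_nonneg i)
      (by simp [Fintype.sum_option])
      (by rintro (_ | i) -
          · exact hQ
          · exact hPmem i)
    rw [Fintype.sum_option, add_comm] at this
    exact this
  set y : Fin n → ℝ := fun i => τ i + if l i = 0 then x i - τ i else 0 with hy
  set ρ : ℝ := t - ∑ i, r i + ∑ i, if l i = 0 then r i else 0 with hρ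
  have hdir : PerspectiveLE g (∑ i, a i * y i) 0 ρ := by
    intro c b hcb
    have h1 : ∑ i, a i * y i = ∑ i, if l i = 0 then a i * (x i - τ i) else 0 := by
      simp only [hy, mul_add, Finset.sum_add_distrib, h.sum_mul_tau, zero_add, mul_ite, mul_zero]
    have h2 : ∑ i, c * (if l i = 0 then a i * (x i - τ i) else 0) ≤
        ∑ i, if l i = 0 then r i else 0 := by
      refine Finset.sum_le_sum fun i _ => ?_
      split_ifs with h0
      · have := h.perspectiveLE i c b hcb
        rwa [h0, mul_zero, sub_zero] at this
      · simp
    rw [← Finset.mul_sum] at h2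
    rw [h1]
    linarith [h.sum_r_le]
  have hyI : ∀ i ∈ Iplus, 0 ≤ y i := by
    intro i hi
    have h1 := h.tau_mem i hi
    simp only [hy]
    split_ifs <;> linarith
  convert add_mem_closure_convexHull_rankOneSet hyI (fun K hK => hdir.apply_mul_le hg hg0 hK)
    hcomb using 1
  refine Prod.ext ?_ (Prod.ext ?_ ?_)
  · have h1 : ∀ i, l i * (r i / l i) = r i - if l i = 0 then r i else 0 := by
      intro i
      split_ifs with h0
      · simp [h0]
      · rw [mul_div_cancel₀ _ h0, sub_zero]
    simp only [Prod.fst_add, Prod.fst_sum, Prod.smul_fst, hP, smul_eq_mul, h1,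
      Finset.sum_sub_distrib, hρ, mul_zero]
    ring
  · funext j
    simp only [Prod.fst_add, Prod.snd_add, Prod.fst_sum, Prod.snd_sum, Prod.smul_fst, Prod.smul_snd,
      hP, Pi.add_apply, Finset.sum_apply, Pi.smul_apply, smul_eq_mul, Pi.zero_apply, mul_zero,
      hy, add_zero]
    rw [Finset.sum_eq_single j (fun i _ hij => by simp [hij.symm]) (by simp), Pi.single_eq_same]
    split_ifs with h0
    · simp [h0]
    · rw [mul_div_cancel₀ _ h0]
      ring
  · funext j
    simp only [Prod.snd_add, Prod.snd_sum, Prod.smul_snd,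
      hP, Pi.add_apply, Finset.sum_apply, Pi.smul_apply, smul_eq_mul, Pi.zero_apply, add_zero]
    have h1 : ∀ i, l i * Function.update m i 1 j =
        l i * m j + if i = j then l j * (1 - m j) else 0 := by
      intro i
      split_ifs with hij
      · subst hij
        rw [Function.update_self]
        ring
      · rw [Function.update_of_ne (Ne.symm hij)]
        ring
    simp only [h1, Finset.sum_add_distrib, ← Finset.sum_mul, Finset.sum_ite_eq', Finset.mem_univ,
      if_true]
    linarith [hmz j]

theorem proposition3 (n : ℕ) (g : ℝ → ℝ) (hg : ConvexOn ℝ Set.univ g) (hg0 : g 0 = 0)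
    (a : Fin n → ℝ) (ha : ∀ i, a i ≠ 0) (Iplus : Set (Fin n))
    (t : ℝ) (x z : Fin n → ℝ) :
    (t, x, z) ∈ closure (convexHull ℝ (rankOneSet g a Iplus)) ↔
      ∃ l τ : Fin n → ℝ,
        (∑ i, perspective g (a i * (x i - τ i)) (l i) ≤ (t : EReal)) ∧
        (∑ i, a i * τ i = 0) ∧ (∀ i ∈ Iplus, 0 ≤ τ i ∧ τ i ≤ x i) ∧
        (∀ i, l i ≤ z i ∧ z i ≤ 1) ∧
        (∀ i, 0 ≤ l i) ∧ ∑ i, l i ≤ 1 := by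
  rw [← mem_certifiedSet_iff hg]
  have hclosed := isClosed_certifiedSet hg hg0 ha Iplus
  have hsub := rankOneSet_subset_certifiedSet hg0 a Iplus
  exact ⟨fun h => closure_minimal
    (convexHull_min hsub (convex_certifiedSet g a Iplus)) hclosed h,
    fun h => certifiedSet_subset_closure hg hg0 a Iplus h⟩
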